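/- For a finite simple graph $G$, let $\tau(G)$ denote the number of spanning trees of $G$, and for $n \ge 0$ let $\mathcal T_n := \{\tau(G) : G \text{ is a simple graph on } n \text{ vertices}\}$. Then for every fixed real $c$ with $0 < c < 1/4$ there is an $n_0$ such that for all integers $n \ge n_0$, $$|\mathcal T_n| \ge \exp(c\, n \log n).$$ -/

import Mathlib

/-- The number `τ(G)` of spanning trees of a graph `G` on a finite vertex set `V`: the number of
subgraphs of `G` containing every vertex (that is, graphs `T ≤ G` on the same vertex set `V`)
that are trees. -/
noncomputable def numSpanningTrees {V : Type*} [Finite V] (G : SimpleGraph V) : ℕ :=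
  {T : SimpleGraph V | T ≤ G ∧ T.IsTree}.ncard

/-- The spanning-tree spectrum `𝒯ₙ`: the set of values `τ(G)` over all simple graphs `G` on
`n` vertices (up to isomorphism, the vertex set is `Fin n`). -/
def spanningTreeSpectrum (n : ℕ) : Set ℕ :=
  {t | ∃ G : SimpleGraph (Fin n), numSpanningTrees G = t}

/-- The spectrum is finite, so its `Set.ncard` is its genuine cardinality. -/
theorem finite_spanningTreeSpectrum (n : ℕ) : (spanningTreeSpectrum n).Finite :=
  Set.finite_range (fun G : SimpleGraph (Fin n) => numSpanningTrees G)

/-! A bounded digit sequence `a` is encoded by two graphs on the same vertices, `doubledPath` and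
`closedDoubledPath`, which differ by one edge. If their two spanning tree counts determine `a`, then
`|𝒯ₙ|²` is at least the number of sequences. With about `δn` possible digits and almost `n/2`
positions, this gives `|𝒯ₙ| ≥ exp(c n log n)` for every `c < 1/4`.

By the matrix-tree theorem and a rank-one update, adding the edge multiplies `τ` by one plus the
effective resistance between its ends. Swapping the two paths reverses the current, so the clique
sits at potential zero. Along a path, Kirchhoff's law then becomes the recurrence of `continuant`:
`a i + 1` clique neighbours and two path neighbours give the coefficient `a i + 3`. The resistance
is thus a function of a negative continued fraction, whose digits can be read off. -/

open Finset

/-! ### Spanning trees as parent functions -/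

section ParentFunctions

variable {V : Type*} {r : V} {f : V → V}

/-- Every orbit of `f` reaches `r`. -/
def ReachesRoot (r : V) (f : V → V) : Prop := ∀ v, ∃ k : ℕ, f^[k] v = r

theorem ReachesRoot.induction (hf : ReachesRoot r f) {P : V → Prop} (h0 : P r)
    (h1 : ∀ v, v ≠ r → P (f v) → P v) (v : V) : P v := by
  obtain ⟨k, hk⟩ := hf v
  induction k generalizing v with
  | zero => exact (show v = r from hk) ▸ h0
  | succ k ih =>
    by_cases hv : v = r
    · exact hv ▸ h0
    · exact h1 v hv (ih (f v) hk)

open Classical in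
/-- The number of steps `f` needs to bring `v` to `r`. -/
noncomputable def ReachesRoot.depth (hf : ReachesRoot r f) (v : V) : ℕ := Nat.find (hf v)

open Classical in
theorem ReachesRoot.depth_apply_lt (hf : ReachesRoot r f) {v : V} (hv : v ≠ r) :
    hf.depth (f v) < hf.depth v := by
  have h := Nat.find_spec (hf v)
  obtain ⟨k, hk⟩ : ∃ k, hf.depth v = k + 1 :=
    Nat.exists_eq_succ_of_ne_zero fun h0 => hv (by
      change f^[hf.depth v] v = r at h
      rwa [h0] at h)
  change f^[hf.depth v] v = r at h
  rw [hk] at h ⊢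
  exact Nat.lt_succ_of_le (Nat.find_min' (hf (f v)) h)

/-- The graph joining every `v ≠ r` to its parent `f v`. -/
def parentGraph (r : V) (f : V → V) : SimpleGraph V :=
  SimpleGraph.fromRel fun v u => v ≠ r ∧ f v = u

theorem ReachesRoot.apply_ne (hf : ReachesRoot r f) {v : V} (hv : v ≠ r) : f v ≠ v := fun h => by
  have := hf.depth_apply_lt hv
  rw [h] at this
  exact this.false

theorem ReachesRoot.parentGraph_adj (hf : ReachesRoot r f) {v : V} (hv : v ≠ r) :
    (parentGraph r f).Adj v (f v) :=
  ⟨(hf.apply_ne hv).symm, Or.inl ⟨hv, rfl⟩⟩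

theorem ReachesRoot.parentGraph_le (hf : ReachesRoot r f) {G : SimpleGraph V} :
    parentGraph r f ≤ G ↔ ∀ v, v ≠ r → G.Adj v (f v) := by
  refine ⟨fun h v hv => h (hf.parentGraph_adj hv), fun h v u huv => ?_⟩
  rcases huv with ⟨-, ⟨hv, rfl⟩ | ⟨hu, rfl⟩⟩
  · exact h v hv
  · exact (h u hu).symm

theorem ReachesRoot.isTree_parentGraph [Finite V] (hf : ReachesRoot r f) :
    (parentGraph r f).IsTree := by
  classical
  have : Fintype V := Fintype.ofFinite V
  have hc : (parentGraph r f).Connected := by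
    have hr : ∀ v, (parentGraph r f).Reachable v r :=
      hf.induction (SimpleGraph.Reachable.refl _) fun v hv h =>
        (hf.parentGraph_adj hv).reachable.trans h
    exact { preconnected := fun u v => (hr u).trans (hr v).symm, nonempty := ⟨r⟩ }
  refine SimpleGraph.isTree_iff_connected_and_card.2
    ⟨hc, le_antisymm ?_ hc.card_vert_le_card_edgeSet_add_one⟩
  have hsub : (parentGraph r f).edgeSet ⊆
      ((univ.erase r).image fun v => s(v, f v) : Finset (Sym2 V)) := by
    intro e
    induction e with | _ v u
    intro hadj
    rcases SimpleGraph.fromRel_adj _ _ _ |>.1 (SimpleGraph.mem_edgeSet _ |>.1 hadj) with ⟨-, ⟨hv, rfl⟩ | ⟨hu, rfl⟩⟩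
    · exact mem_coe.2 (mem_image.2 ⟨v, by simp [hv], rfl⟩)
    · exact mem_coe.2 (mem_image.2 ⟨u, by simp [hu], Sym2.eq_swap⟩)
  have h1 := Set.ncard_le_ncard hsub (Finset.finite_toSet _)
  rw [Set.ncard_coe_finset] at h1
  have h2 : #((univ.erase r).image fun v => s(v, f v)) ≤ Fintype.card V - 1 :=
    card_image_le.trans (by simp [card_erase_of_mem])
  have h3 : 0 < Fintype.card V := Fintype.card_pos_iff.2 ⟨r⟩
  rw [Nat.card_eq_fintype_card (α := V), Nat.card_coe_set_eq]
  omega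

/-- Where `f` and `g` differ at `v`, the edge from `v` to `f v` must come from `g (f v) = v`. If
they already agree at `f v`, then `f (f v) = v`, but depth strictly decreases along `f`. -/
theorem ReachesRoot.eq_of_parentGraph_eq {g : V → V} (hf : ReachesRoot r f)
    (hfr : f r = r) (hgr : g r = r)
    (h : parentGraph r f = parentGraph r g) : f = g := by
  have key : ∀ v, v ≠ r → f v ≠ g v → f v ≠ r ∧ g (f v) = v := by
    intro v hv hne
    have hadj := hf.parentGraph_adj hv
    rw [h] at hadj
    rcases hadj with ⟨-, ⟨-, h1⟩ | h1⟩
    · exact absurd h1.symm hne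
    · exact h1
  refine funext <| hf.induction (hfr.trans hgr.symm) fun v hv ih => ?_
  by_contra hne
  obtain ⟨h1, h2⟩ := key v hv hne
  have h3 := hf.depth_apply_lt hv
  have h4 := hf.depth_apply_lt h1
  rw [ih, h2] at h4
  exact (h3.trans h4).false

theorem exists_reachesRoot_parentGraph_eq [Finite V] (r : V) {T : SimpleGraph V} (hT : T.IsTree) :
    ∃ f : V → V, f r = r ∧ ReachesRoot r f ∧ parentGraph r f = T := by
  classical
  have hex : ∀ v, v ≠ r → ∃ u, T.Adj v u ∧ T.dist u r < T.dist v r := by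
    intro v hv
    obtain ⟨p, hp⟩ := hT.connected.exists_walk_length_eq_dist v r
    cases p with
    | nil => exact absurd rfl hv
    | cons hadj q =>
      refine ⟨_, hadj, ?_⟩
      have := SimpleGraph.dist_le q
      rw [SimpleGraph.Walk.length_cons] at hp
      omega
  choose! f hf1 hf2 using hex
  have hfT : ∀ v, v ≠ r → Function.update f r r v = f v := fun v hv =>
    Function.update_of_ne hv _ _
  have hreach : ReachesRoot r (Function.update f r r) := by
    intro v
    induction hd : T.dist v r using Nat.strong_induction_on generalizing v with | _ d ih
    by_cases hv : v = r
    · exact ⟨0, hv⟩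
    · obtain ⟨k, hk⟩ := ih _ (hd ▸ hf2 v hv) (f v) rfl
      exact ⟨k + 1, by rwa [Function.iterate_succ_apply, hfT v hv]⟩
  refine ⟨_, Function.update_self .., hreach, ?_⟩
  have hle : parentGraph r (Function.update f r r) ≤ T :=
    hreach.parentGraph_le.2 fun v hv => (hfT v hv).symm ▸ hf1 v hv
  -- A tree has no proper connected spanning subgraph.
  exact le_antisymm hle ((SimpleGraph.isTree_iff_minimal_connected.1 hT).2
    hreach.isTree_parentGraph.connected hle)

end ParentFunctions

/-! ### Matrix-tree theorem and the effect of adding an edge -/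

section MatrixTree

variable {V : Type*} [Fintype V] [DecidableEq V]

/-- The row contributed by the choice of `u` as the parent of `v`. -/
def parentRow (r v u : V) : V → ℚ :=
  if v = r then Pi.single r 1 else Pi.single v 1 - Pi.single u 1

/-- Ordering the vertices by depth makes the matrix unitriangular. -/
theorem det_parentRow_of_reachesRoot {r : V} {f : V → V} (hf : ReachesRoot r f) :
    Matrix.det (Matrix.of fun v => parentRow r v (f v)) = 1 := by
  set M : Matrix V V ℚ := Matrix.of fun v => parentRow r v (f v)
  have hM : ∀ v u, hf.depth v ≤ hf.depth u → M v u = if v = u then 1 else 0 := by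
    intro v u huv
    by_cases hv : v = r
    · subst hv
      simp [M, parentRow, Pi.single_apply, eq_comm]
    · have : u ≠ f v := by
        rintro rfl
        exact (hf.depth_apply_lt hv).not_ge huv
      change parentRow r v (f v) u = _
      rw [parentRow, if_neg hv]
      simp [Pi.single_apply, this, eq_comm]
  have htri : M.BlockTriangular fun v => OrderDual.toDual (hf.depth v) := fun v u huv => by
    have huv : hf.depth v < hf.depth u := huv
    rw [hM v u huv.le, if_neg (by rintro rfl; exact huv.false)]
  rw [htri.det]
  refine prod_eq_one fun k _ => ?_
  convert Matrix.det_one (R := ℚ) (n := {v // OrderDual.toDual (hf.depth v) = k})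
  ext ⟨v, hv⟩ ⟨u, hu⟩
  have : hf.depth v = hf.depth u := OrderDual.toDual.injective (hv.trans hu.symm)
  simp [Matrix.toSquareBlock_def, hM v u this.le, Matrix.one_apply]

theorem det_parentRow_of_not_reachesRoot {r : V} {f : V → V} (hfr : f r = r)
    (hf : ¬ ReachesRoot r f) :
    Matrix.det (Matrix.of fun v => parentRow r v (f v)) = 0 := by
  classical
  obtain ⟨v₀, hv₀⟩ := not_forall.1 hf
  -- The indicator of the vertices that never reach `r` is constant along `f` and vanishes at `r`,
  -- so it lies in the kernel.
  refine Matrix.exists_mulVec_eq_zero_iff.1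
    ⟨fun v => if ∃ k : ℕ, f^[k] v = r then 0 else 1, fun h => ?_, ?_⟩
  · simpa [hv₀] using congrFun h v₀
  · funext v
    have hiff : (∃ k : ℕ, f^[k] (f v) = r) ↔ ∃ k : ℕ, f^[k] v = r := by
      refine ⟨fun ⟨k, hk⟩ => ⟨k + 1, hk⟩, fun ⟨k, hk⟩ => ⟨k, ?_⟩⟩
      rw [← Function.iterate_succ_apply, Function.iterate_succ_apply', hk, hfr]
    by_cases hv : v = r
    · subst hv
      simpa [Matrix.mulVec, parentRow] using ⟨0, rfl⟩
    · change parentRow r v (f v) ⬝ᵥ _ = 0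
      rw [parentRow, if_neg hv, sub_dotProduct]
      simp [hiff]

open Classical in
/-- The vertices allowed as parent of `v`: its neighbours, and only `r` itself for the root. -/
noncomputable def parentChoices (G : SimpleGraph V) (r v : V) : Finset V :=
  if v = r then {r} else univ.filter (G.Adj v)

/-- The Laplacian of `G` over `ℚ`, with the row of the root `r` replaced by a unit vector. -/
noncomputable def rootedLaplacian (G : SimpleGraph V) (r : V) : Matrix V V ℚ :=
  Matrix.of fun v => ∑ u ∈ parentChoices G r v, parentRow r v u

/-- **Matrix-tree theorem.** -/
theorem det_rootedLaplacian (G : SimpleGraph V) (r : V) :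
    (rootedLaplacian G r).det = numSpanningTrees G := by
  classical
  -- Each row is a sum over parent choices, so multilinearity expands the determinant over parent
  -- functions.
  have hexp : (rootedLaplacian G r).det = ∑ f ∈ Fintype.piFinset (parentChoices G r),
      Matrix.det (Matrix.of fun v => parentRow r v (f v)) :=
    (Matrix.detRowAlternating (n := V) (R := ℚ)).toMultilinearMap.map_sum_finset
      (fun v u => parentRow r v u) (parentChoices G r)
  have hmem : ∀ f, f ∈ Fintype.piFinset (parentChoices G r) ↔
      f r = r ∧ ∀ v, v ≠ r → G.Adj v (f v) := by
    intro f
    rw [Fintype.mem_piFinset]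
    refine ⟨fun h => ⟨by simpa [parentChoices] using h r, fun v hv => ?_⟩, fun ⟨h1, h2⟩ v => ?_⟩
    · simpa [parentChoices, hv] using h v
    · by_cases hv : v = r
      · subst hv
        simpa [parentChoices] using h1
      · simpa [parentChoices, hv] using h2 v hv
  have hdet : ∀ f ∈ Fintype.piFinset (parentChoices G r),
      Matrix.det (Matrix.of fun v => parentRow r v (f v)) =
        if ReachesRoot r f then (1 : ℚ) else 0 := by
    intro f hf
    split_ifs with h
    · exact det_parentRow_of_reachesRoot h
    · exact det_parentRow_of_not_reachesRoot ((hmem f).1 hf).1 h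
  rw [hexp, sum_congr rfl hdet, sum_boole, numSpanningTrees, ← Set.ncard_coe_finset]
  congr 1
  refine Set.ncard_congr (fun f _ => parentGraph r f) ?_ ?_ ?_
  · intro f hf
    rw [mem_coe, mem_filter, hmem] at hf
    exact ⟨hf.2.parentGraph_le.2 hf.1.2, hf.2.isTree_parentGraph⟩
  · intro f g hf hg h
    rw [mem_coe, mem_filter, hmem] at hf hg
    exact hf.2.eq_of_parentGraph_eq hf.1.1 hg.1.1 h
  · rintro T ⟨hTG, hT⟩
    obtain ⟨f, hfr, hf, rfl⟩ := exists_reachesRoot_parentGraph_eq r hT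
    refine ⟨f, ?_, rfl⟩
    rw [mem_coe, mem_filter, hmem]
    exact ⟨⟨hfr, hf.parentGraph_le.1 hTG⟩, hf⟩

omit [DecidableEq V] in
theorem numSpanningTrees_pos {G : SimpleGraph V} (hG : G.Connected) : 0 < numSpanningTrees G := by
  obtain ⟨T, hTG, hT⟩ := hG.exists_isTree_le
  exact (Set.ncard_pos (Set.toFinite _)).2 ⟨T, hTG, hT⟩

theorem rootedLaplacian_mulVec (G : SimpleGraph V) [DecidableRel G.Adj] (r : V) (x : V → ℚ) (v : V) :
    (rootedLaplacian G r).mulVec x v =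
      if v = r then x r else ∑ u, if G.Adj v u then x v - x u else 0 := by
  by_cases hv : v = r
  · simp [Matrix.mulVec, rootedLaplacian, parentChoices, parentRow, hv]
  · change (∑ u ∈ parentChoices G r v, parentRow r v u) ⬝ᵥ x = _
    simp only [parentChoices, parentRow, if_neg hv, sum_dotProduct, sub_dotProduct,
      single_one_dotProduct]
    rw [sum_filter]
    exact sum_congr rfl fun u _ => by congr

theorem rootedLaplacian_sup_edge (G : SimpleGraph V) {r s t : V} (hst : s ≠ t) (hs : s ≠ r)
    (ht : t ≠ r) (hadj : ¬ G.Adj s t) :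
    rootedLaplacian (G ⊔ SimpleGraph.edge s t) r = rootedLaplacian G r +
      Matrix.vecMulVec (Pi.single s 1 - Pi.single t 1) (Pi.single s 1 - Pi.single t 1) := by
  classical
  refine Matrix.ext_iff_mulVec.2 fun x => funext fun v => ?_
  rw [Matrix.add_mulVec, Pi.add_apply, rootedLaplacian_mulVec, rootedLaplacian_mulVec,
    Matrix.vecMulVec_mulVec, sub_dotProduct, single_one_dotProduct, single_one_dotProduct]
  by_cases hv : v = r
  · subst hv
    simp [hs.symm, ht.symm]
  have hsplit : ∀ u, (if (G ⊔ SimpleGraph.edge s t).Adj v u then x v - x u else 0) =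
      (if G.Adj v u then x v - x u else 0) +
        ((if v = s then if u = t then x v - x u else 0 else 0) +
          (if v = t then if u = s then x v - x u else 0 else 0)) := by
    intro u
    have hadj' : ¬ G.Adj t s := fun h => hadj h.symm
    simp only [SimpleGraph.sup_adj, SimpleGraph.edge_adj]
    by_cases h1 : v = s <;> by_cases h2 : v = t <;> by_cases h3 : u = s <;> by_cases h4 : u = t <;>
      simp_all
  rw [if_neg hv, if_neg hv, sum_congr rfl fun u _ => hsplit u, sum_add_distrib, sum_add_distrib]
  congr 1
  by_cases h1 : v = s
  · subst h1
    simp [hst]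
  · by_cases h2 : v = t
    · subst h2
      simp [h1]
    · simp [h1, h2]

/-- The matrix determinant lemma for a rank-one update. Here `x` is the potential of a unit current
from `s` to `t`, and `x s - x t` is the effective resistance. -/
theorem numSpanningTrees_sup_edge (G : SimpleGraph V) {r s t : V} (hst : s ≠ t) (hs : s ≠ r)
    (ht : t ≠ r) (hadj : ¬ G.Adj s t) {x : V → ℚ}
    (hx : (rootedLaplacian G r).mulVec x = Pi.single s 1 - Pi.single t 1) :
    (numSpanningTrees (G ⊔ SimpleGraph.edge s t) : ℚ) =
      numSpanningTrees G * (1 + (x s - x t)) := by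
  rw [← det_rootedLaplacian _ r, ← det_rootedLaplacian _ r,
    rootedLaplacian_sup_edge G hst hs ht hadj]
  set u : V → ℚ := Pi.single s 1 - Pi.single t 1 with hu
  have : rootedLaplacian G r + Matrix.vecMulVec u u =
      rootedLaplacian G r * (1 + Matrix.vecMulVec x u) := by
    rw [mul_add, mul_one, Matrix.mul_vecMulVec, hx]
  rw [this, Matrix.det_mul, Matrix.vecMulVec_eq Unit, Matrix.det_one_add_replicateCol_mul_replicateRow]
  simp [hu, sub_dotProduct]

end MatrixTree

theorem numSpanningTrees_congr {V W : Type*} [Finite V] [Finite W] {G : SimpleGraph V}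
    {H : SimpleGraph W} (e : G ≃g H) : numSpanningTrees G = numSpanningTrees H := by
  refine Set.ncard_congr (fun T _ => T.comap e.symm) ?_ ?_ ?_
  · rintro T ⟨hTG, hT⟩
    refine ⟨fun v u h => e.symm.map_adj_iff.1 (hTG h), ?_⟩
    exact (SimpleGraph.Iso.comap e.symm.toEquiv T).isTree_iff.2 hT
  · intro T T' _ _ h
    ext v u
    have := congrArg (fun S : SimpleGraph W => S.Adj (e v) (e u)) h
    simpa using this
  · rintro T ⟨hTH, hT⟩
    refine ⟨T.comap e, ⟨fun v u h => e.map_adj_iff.1 (hTH h), ?_⟩, ?_⟩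
    · exact (SimpleGraph.Iso.comap e.toEquiv T).isTree_iff.2 hT
    · ext v u
      simp

/-! ### Negative continued fractions -/

section ContinuedFraction

/-- The continuants of the negative continued fraction with partial quotients `a k + 3`. -/
def continuant (a : ℕ → ℕ) : ℕ → ℚ
  | 0 => 1
  | 1 => 1
  | k + 2 => (a k + 3) * continuant a (k + 1) - continuant a k

theorem continuant_pos_and_le (a : ℕ → ℕ) (k : ℕ) :
    0 < continuant a k ∧ continuant a k ≤ continuant a (k + 1) := by
  induction k with
  | zero => simp [continuant]
  | succ k ih =>
    refine ⟨ih.1.trans_le ih.2, ?_⟩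
    have h0 : (0 : ℚ) ≤ a k := Nat.cast_nonneg _
    rw [continuant]
    nlinarith

theorem continuant_pos (a : ℕ → ℕ) (k : ℕ) : 0 < continuant a k := (continuant_pos_and_le a k).1

theorem continuant_lt_succ (a : ℕ → ℕ) (k : ℕ) :
    continuant a (k + 1) < continuant a (k + 2) := by
  have h0 : (0 : ℚ) ≤ a k := Nat.cast_nonneg _
  obtain ⟨h1, h2⟩ := continuant_pos_and_le a k
  rw [continuant]
  nlinarith

theorem continuant_ratio_succ (a : ℕ → ℕ) (k : ℕ) :
    continuant a (k + 2) / continuant a (k + 1) =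
      a k + 3 - (continuant a (k + 1) / continuant a k)⁻¹ := by
  have h1 := (continuant_pos a (k + 1)).ne'
  rw [continuant, inv_div, sub_div, mul_div_cancel_right₀ _ h1]

theorem inv_continuant_ratio_mem (a : ℕ → ℕ) (k : ℕ) :
    0 < (continuant a (k + 1) / continuant a k)⁻¹ ∧
      (continuant a (k + 1) / continuant a k)⁻¹ ≤ 1 := by
  have h1 := continuant_pos a (k + 1)
  obtain ⟨h0, h2⟩ := continuant_pos_and_le a k
  rw [inv_div]
  exact ⟨by positivity, (div_le_one h1).2 h2⟩

/-- The partial quotients are determined by the value of the continued fraction. -/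
theorem eq_of_continuant_ratio_eq {a b : ℕ → ℕ} {m : ℕ}
    (h : continuant a (m + 1) / continuant a m = continuant b (m + 1) / continuant b m) :
    ∀ k < m, a k = b k := by
  induction m with
  | zero => simp
  | succ m ih =>
    rw [continuant_ratio_succ, continuant_ratio_succ] at h
    obtain ⟨ha0, ha1⟩ := inv_continuant_ratio_mem a m
    obtain ⟨hb0, hb1⟩ := inv_continuant_ratio_mem b m
    -- Both subtracted inverses lie in `(0, 1]`, so the two integers differ by less than one.
    have hab : a m = b m := by
      have h1 : (a m : ℚ) < b m + 1 := by linarith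
      have h2 : (b m : ℚ) < a m + 1 := by linarith
      norm_cast at h1 h2
      omega
    rw [hab] at h
    have hr := inv_injective (sub_right_injective h)
    intro k hk
    rcases Nat.lt_succ_iff_lt_or_eq.1 hk with hk | rfl
    · exact ih hr k hk
    · exact hab

end ContinuedFraction

/-! ### The encoding graphs and their effective resistance -/

section DoubledPath

/-- Two disjoint copies of a path on `m + 1` vertices together with a clique on `p + 1` vertices;
both copies of the `i`-th path vertex are joined to the clique vertices `0, …, a i`. -/
def doubledPath (p m : ℕ) (a : ℕ → ℕ) : SimpleGraph (Fin (p + 1) ⊕ Fin (m + 1) × Bool) where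
  Adj
    | .inl j, .inl k => j ≠ k
    | .inl j, .inr v => (j : ℕ) ≤ a v.1
    | .inr v, .inl j => (j : ℕ) ≤ a v.1
    | .inr v, .inr w => v.2 = w.2 ∧ ((v.1 : ℕ) + 1 = w.1 ∨ (w.1 : ℕ) + 1 = v.1)
  symm := ⟨by
    rintro (j | v) (k | w) h
    · exact Ne.symm h
    · exact h
    · exact h
    · exact ⟨h.1.symm, h.2.symm⟩⟩
  loopless := ⟨by
    rintro (j | v) h
    · exact h rfl
    · exact h.2.elim (Nat.succ_ne_self _) (Nat.succ_ne_self _)⟩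

variable {p m : ℕ} (a : ℕ → ℕ)

theorem doubledPath_connected : (doubledPath p m a).Connected := by
  have h : ∀ v, (doubledPath p m a).Reachable v (.inl 0) := by
    rintro (j | v)
    · by_cases hj : j = 0
      · rw [hj]
      · exact SimpleGraph.Adj.reachable (G := doubledPath p m a) hj
    · exact SimpleGraph.Adj.reachable (G := doubledPath p m a) (Nat.zero_le _)
  exact { preconnected := fun u v => (h u).trans (h v).symm, nonempty := ⟨.inl 0⟩ }

/-- The electric potential for a unit current between the last vertices of the two paths. -/
def doubledPathPotential (p m : ℕ) (a : ℕ → ℕ) : Fin (p + 1) ⊕ Fin (m + 1) × Bool → ℚ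
  | .inl _ => 0
  | .inr v => (if v.2 then -1 else 1) * continuant a (v.1 + 1) /
      (continuant a (m + 2) - continuant a (m + 1))

/-- This is the continuant recurrence. The missing neighbour before the first vertex costs nothing
because the continuants at `0` and `1` agree; the one after the last vertex leaves the boundary
term. -/
theorem sum_path_continuant_sub (i : Fin (m + 1)) :
    (∑ j : Fin (m + 1), if (i : ℕ) + 1 = j ∨ (j : ℕ) + 1 = i then
      continuant a (i + 1) - continuant a (j + 1) else 0) =
    (if i = Fin.last m then continuant a (m + 2) - continuant a (m + 1) else 0) -
      (a i + 1) * continuant a (i + 1) := by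
  rw [Fin.sum_univ_eq_sum_range (fun j => if (i : ℕ) + 1 = j ∨ j + 1 = (i : ℕ) then
      continuant a (i + 1) - continuant a (j + 1) else 0)]
  obtain ⟨i, hi⟩ := i
  have hsplit : ∀ j, (if i + 1 = j ∨ j + 1 = i then
      continuant a (i + 1) - continuant a (j + 1) else 0) =
      (if i + 1 = j then continuant a (i + 1) - continuant a (j + 1) else 0) +
        (if j + 1 = i then continuant a (i + 1) - continuant a i else 0) := by
    intro j
    by_cases h1 : i + 1 = j
    · simp [h1, show j + 1 ≠ i by omega]
    · by_cases h2 : j + 1 = i <;> simp [h1, h2]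
  have hdown : (∑ j ∈ range (m + 1),
      if j + 1 = i then continuant a (i + 1) - continuant a i else 0) =
      continuant a (i + 1) - continuant a i := by
    cases i with
    | zero => simp [continuant]
    | succ i => simp [show i < m + 1 by omega]
  simp only [hsplit, sum_add_distrib, hdown, sum_ite_eq, mem_range, Fin.ext_iff, Fin.val_last]
  by_cases him : i = m
  · subst him
    simp [continuant]
    ring
  · rw [if_pos (by omega), if_neg him, continuant]
    ring

theorem rootedLaplacian_mulVec_doubledPathPotential (ha : ∀ k, a k ≤ p) :
    (rootedLaplacian (doubledPath p m a) (.inl 0)).mulVec (doubledPathPotential p m a) =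
      Pi.single (.inr (Fin.last m, false)) 1 - Pi.single (.inr (Fin.last m, true)) 1 := by
  classical
  have hC : continuant a (m + 2) - continuant a (m + 1) ≠ 0 :=
    (sub_pos.2 (continuant_lt_succ a m)).ne'
  funext v
  rw [rootedLaplacian_mulVec]
  rcases v with j | ⟨i, b⟩
  -- At a clique vertex the contributions of the two path copies cancel.
  · have : ∀ v, ((doubledPath p m a).Adj (.inl j) (.inr (v, false)) ↔ (j : ℕ) ≤ a v) ∧
        ((doubledPath p m a).Adj (.inl j) (.inr (v, true)) ↔ (j : ℕ) ≤ a v) :=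
      fun v => ⟨Iff.rfl, Iff.rfl⟩
    simp only [Fintype.sum_sum_type, Fintype.sum_prod_type, Fintype.sum_bool, this,
      doubledPathPotential]
    simp [← ite_add_zero, neg_div]
  · have h1 : ∀ j, (doubledPath p m a).Adj (.inr (i, b)) (.inl j) ↔ (j : ℕ) ≤ a i :=
      fun j => Iff.rfl
    have h2 : ∀ k c, (doubledPath p m a).Adj (.inr (i, b)) (.inr (k, c)) ↔
      b = c ∧ ((i : ℕ) + 1 = k ∨ (k : ℕ) + 1 = i) := fun k c => Iff.rfl
    -- The bound `a i ≤ p` ensures that the clique has all `a i + 1` required neighbours.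
    have hcard : #(univ.filter fun j : Fin (p + 1) => (j : ℕ) ≤ a i) = a i + 1 := by
      rw [← Fin.card_Iic (⟨a i, Nat.lt_succ_of_le (ha i)⟩ : Fin (p + 1))]
      congr 1
      ext j
      simp [Fin.le_def]
    have hpath := sum_path_continuant_sub a i
    rw [if_neg (by simp), Fintype.sum_sum_type, Fintype.sum_prod_type]
    simp only [h1, h2, doubledPathPotential, sub_zero]
    rw [← sum_filter, sum_const, hcard]
    generalize continuant a (m + 2) - continuant a (m + 1) = C at hC hpath ⊢
    have hsum : ∀ k : Fin (m + 1), (∑ c : Bool, if b = c ∧ ((i : ℕ) + 1 = k ∨ (k : ℕ) + 1 = i) then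
        (if b then -1 else 1) * continuant a (i + 1) / C -
          (if c then -1 else 1) * continuant a (k + 1) / C else 0) =
        (if b then -1 else 1) / C * (if (i : ℕ) + 1 = k ∨ (k : ℕ) + 1 = i then
          continuant a (i + 1) - continuant a (k + 1) else 0) := by
      intro k
      rw [Fintype.sum_bool]
      split_ifs <;> cases b <;> simp_all <;> ring
    rw [sum_congr rfl fun k _ => hsum k, ← mul_sum, hpath]
    cases b <;> by_cases hi : i = Fin.last m <;> simp [hi] <;> field_simp <;> ring

/-- The doubled path with an additional edge between the last vertices of the two paths. -/
def closedDoubledPath (p m : ℕ) (a : ℕ → ℕ) : SimpleGraph (Fin (p + 1) ⊕ Fin (m + 1) × Bool) :=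
  doubledPath p m a ⊔ SimpleGraph.edge (.inr (Fin.last m, false)) (.inr (Fin.last m, true))

theorem numSpanningTrees_closedDoubledPath (ha : ∀ k, a k ≤ p) :
    (numSpanningTrees (closedDoubledPath p m a) : ℚ) = numSpanningTrees (doubledPath p m a) *
      (1 + 2 / (continuant a (m + 2) / continuant a (m + 1) - 1)) := by
  have hnadj : ¬ (doubledPath p m a).Adj (.inr (Fin.last m, false)) (.inr (Fin.last m, true)) :=
    fun h => Bool.false_ne_true h.1
  rw [closedDoubledPath, numSpanningTrees_sup_edge _ (by simp) (by simp) (by simp) hnadj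
    (rootedLaplacian_mulVec_doubledPathPotential a ha)]
  have h1 := continuant_pos a (m + 1)
  have h2 : continuant a (m + 2) - continuant a (m + 1) ≠ 0 :=
    (sub_pos.2 (continuant_lt_succ a m)).ne'
  congr 2
  simp only [doubledPathPotential, Fin.val_last, Bool.false_eq_true, if_true, if_false]
  rw [div_sub_one h1.ne']
  field_simp
  ring

/-- The quotient of the two counts is an injective function of the continued fraction; dividing is
legitimate since the open graph is connected. -/
theorem eq_of_numSpanningTrees_doubledPath_eq {a b : ℕ → ℕ} (ha : ∀ k, a k ≤ p)
    (hb : ∀ k, b k ≤ p)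
    (h1 : numSpanningTrees (doubledPath p m a) = numSpanningTrees (doubledPath p m b))
    (h2 : numSpanningTrees (closedDoubledPath p m a) =
      numSpanningTrees (closedDoubledPath p m b)) : ∀ k < m + 1, a k = b k := by
  refine eq_of_continuant_ratio_eq ?_
  have h3 := congrArg (Nat.cast (R := ℚ)) h2
  rw [numSpanningTrees_closedDoubledPath a ha, numSpanningTrees_closedDoubledPath b hb, h1] at h3
  have h4 : (numSpanningTrees (doubledPath p m b) : ℚ) ≠ 0 :=
    Nat.cast_ne_zero.2 (numSpanningTrees_pos (doubledPath_connected b)).ne'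
  have h5 := add_left_cancel (mul_left_cancel₀ h4 h3)
  simp only [div_eq_mul_inv (2 : ℚ)] at h5
  exact sub_left_injective (inv_injective (mul_left_cancel₀ two_ne_zero h5))

theorem pow_le_ncard_spanningTreeSpectrum_sq (p m : ℕ) :
    (p + 1) ^ (m + 1) ≤ (spanningTreeSpectrum (p + 1 + 2 * (m + 1))).ncard ^ 2 := by
  classical
  set n := p + 1 + 2 * (m + 1) with hn
  have e : Fin (p + 1) ⊕ Fin (m + 1) × Bool ≃ Fin n :=
    Fintype.equivFinOfCardEq (by simp [hn, mul_comm])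
  have hmem : ∀ G : SimpleGraph (Fin (p + 1) ⊕ Fin (m + 1) × Bool),
      numSpanningTrees G ∈ (finite_spanningTreeSpectrum n).toFinset := fun G =>
    (Set.Finite.mem_toFinset _).2
      ⟨G.comap e.symm, numSpanningTrees_congr (SimpleGraph.Iso.comap e.symm G)⟩
  let digits (a : Fin (m + 1) → Fin (p + 1)) (k : ℕ) : ℕ := if h : k < m + 1 then a ⟨k, h⟩ else 0
  have hdigits : ∀ a k, digits a k ≤ p := by
    intro a k
    simp only [digits]
    split_ifs
    · exact Nat.lt_succ_iff.1 (a _).2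
    · exact Nat.zero_le _
  have hcard := Finset.card_le_card_of_injOn
    (s := (univ : Finset (Fin (m + 1) → Fin (p + 1))))
    (t := (finite_spanningTreeSpectrum n).toFinset ×ˢ (finite_spanningTreeSpectrum n).toFinset)
    (fun a => (numSpanningTrees (doubledPath p m (digits a)),
      numSpanningTrees (closedDoubledPath p m (digits a))))
    (fun a _ => mem_coe.2 (mem_product.2 ⟨hmem _, hmem _⟩))
    (fun a _ b _ hab => funext fun i => Fin.ext (by
      have := eq_of_numSpanningTrees_doubledPath_eq (hdigits a) (hdigits b)
        (congrArg Prod.fst hab) (congrArg Prod.snd hab) i i.2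
      simpa only [digits, dif_pos i.2] using this))
  rwa [card_univ, Fintype.card_fun, Fintype.card_fin, Fintype.card_fin, card_product, ← sq,
    ← Set.ncard_eq_toFinset_card _ (finite_spanningTreeSpectrum n)] at hcard

end DoubledPath

/-! ### Choice of parameters and asymptotics -/

theorem pow_le_ncard_spanningTreeSpectrum_sq_of_add_eq {n q M : ℕ} (hq : 0 < q) (hM : 0 < M)
    (hn : q + 2 * M = n) : q ^ M ≤ (spanningTreeSpectrum n).ncard ^ 2 := by
  obtain ⟨p, rfl⟩ := Nat.exists_eq_add_of_le' hq
  obtain ⟨m, rfl⟩ := Nat.exists_eq_add_of_le' hM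
  subst hn
  exact pow_le_ncard_spanningTreeSpectrum_sq p m

theorem theorem1p1 (c : ℝ) (hc0 : 0 < c) (hc : c < 1 / 4) :
    ∀ᶠ n : ℕ in Filter.atTop,
      Real.exp (c * (n : ℝ) * Real.log (n : ℝ)) ≤ ((spanningTreeSpectrum n).ncard : ℝ) := by
  -- With `q` about `δn`, the length `M` is about `(1 - δ)n/2`, which exceeds `(1 + 4c)n/4` by
  -- `δn/2`; this absorbs rounding. The exponent `θ < 1` is chosen so that `θ(1 + 4c)/4 = 2c`, and
  -- `q ≥ n^θ` for large `n`.
  set δ : ℝ := (1 - 4 * c) / 4 with hδ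
  have hδ0 : 0 < δ := by linarith
  set θ : ℝ := 8 * c / (1 + 4 * c) with hθ
  have hθ1 : θ < 1 := by
    rw [hθ, div_lt_one (by linarith)]
    linarith
  have hlog : ∀ᶠ n : ℕ in Filter.atTop, -Real.log (δ / 2) / (1 - θ) ≤ Real.log n :=
    (Real.tendsto_log_atTop.comp tendsto_natCast_atTop_atTop).eventually_ge_atTop _
  have hlarge : ∀ᶠ n : ℕ in Filter.atTop, 2 / δ ≤ (n : ℝ) :=
    tendsto_natCast_atTop_atTop.eventually_ge_atTop _
  filter_upwards [hlog, hlarge] with n hn1 hn2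
  rw [div_le_iff₀ (by linarith)] at hn1
  rw [div_le_iff₀ hδ0] at hn2
  have hn0 : (0 : ℝ) < n := by
    by_contra h
    nlinarith
  have hfl : ⌊δ * n⌋₊ ≤ δ * n := Nat.floor_le (by positivity)
  have hfl' : δ * n < ⌊δ * n⌋₊ + 1 := Nat.lt_floor_add_one _
  have hfn : ⌊δ * n⌋₊ ≤ n := by
    have : (⌊δ * n⌋₊ : ℝ) ≤ n := by nlinarith
    exact_mod_cast this
  -- Since `n - q` must be even, `q` takes up the possible leftover vertex.
  obtain ⟨M, q, hqn, hq, hM⟩ : ∃ M q : ℕ, q + 2 * M = n ∧ ⌊δ * n⌋₊ ≤ q ∧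
      n ≤ ⌊δ * n⌋₊ + 2 * M + 1 :=
    ⟨(n - ⌊δ * n⌋₊) / 2, n - 2 * ((n - ⌊δ * n⌋₊) / 2), by omega, by omega, by omega⟩
  have hq' : (⌊δ * n⌋₊ : ℝ) ≤ q := by exact_mod_cast hq
  have hM' : (n : ℝ) ≤ ⌊δ * n⌋₊ + 2 * M + 1 := by exact_mod_cast hM
  have hqδ : δ / 2 * n ≤ q := by nlinarith
  have hMn : (1 + 4 * c) / 4 * n ≤ M := by nlinarith
  have hq0 : (0 : ℝ) < q := lt_of_lt_of_le (by positivity) hqδ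
  have hM0 : (0 : ℝ) < M := lt_of_lt_of_le (by positivity) hMn
  have hlogn : 0 ≤ Real.log n := Real.log_natCast_nonneg n
  have hlogq : θ * Real.log n ≤ Real.log q := by
    have h := Real.log_le_log (by positivity) hqδ
    rw [Real.log_mul (by positivity) hn0.ne'] at h
    linarith
  have hmain : 2 * (c * n * Real.log n) ≤ M * Real.log q := by
    have hθ0 : 0 ≤ θ := by positivity
    calc 2 * (c * n * Real.log n) = (1 + 4 * c) / 4 * n * (θ * Real.log n) := by
          rw [hθ]
          field_simp
          ring
      _ ≤ M * Real.log q := by gcongr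
  have hpow : ((q : ℝ)) ^ M ≤ ((spanningTreeSpectrum n).ncard : ℝ) ^ 2 := by
    exact_mod_cast pow_le_ncard_spanningTreeSpectrum_sq_of_add_eq
      (Nat.cast_pos.1 hq0) (Nat.cast_pos.1 hM0) hqn
  refine (sq_le_sq₀ (Real.exp_pos _).le (Nat.cast_nonneg _)).1 ?_
  calc Real.exp (c * n * Real.log n) ^ 2 = Real.exp (2 * (c * n * Real.log n)) := by
        rw [← Real.exp_nat_mul, Nat.cast_ofNat]
    _ ≤ Real.exp (M * Real.log q) := Real.exp_le_exp.2 hmain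
    _ = (q : ℝ) ^ M := by rw [Real.exp_nat_mul, Real.exp_log hq0]
    _ ≤ _ := hpow
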